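/- Let $N\cong\mathbb{Z}^n$ be a lattice with dual lattice $M$, and let dual $\mathbb{Z}$-bases $e_1,\dots,e_n$ of $N$ and $e_1^*,\dots,e_n^*$ of $M$ be declared orthonormal in $N_{\mathbb{R}}$ and $M_{\mathbb{R}}$; write $y\mapsto y^*$ for the isometry $N_{\mathbb{R}}\to M_{\mathbb{R}}$ with $e_j\mapsto e_j^*$, and $T^*M_{\mathbb{R}}=M_{\mathbb{R}}\times N_{\mathbb{R}}$. The normalized geodesic flow on the complement of the zero section is $$\gamma_t(x,y)=\Bigl(x+\frac{t\,y^*}{|y^*|},\,y\Bigr),\qquad x\in M_{\mathbb{R}},\ y\in N_{\mathbb{R}}\setminus\{0\}.$$ Let $X_\Sigma$ be a nonsingular projective complex toric variety of dimension $n$ defined by a complete fan $\Sigma\subset N_{\mathbb{R}}$, with primitive ray generators $v_1,\dots,v_r\in N$ and torus-invariant prime divisors $D_1,\dots,D_r$. Let $\vec c\in\mathbb{Z}^r$ be such that $\mathcal{L}_{\vec c}=\mathcal{O}_{X_\Sigma}(\sum_i c_iD_i)$ is ample, and let $h$ be a hermitian metric on $\mathcal{L}_{\vec c}$ that is real analytic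 and invariant under the compact torus $T_{\mathbb{R}}=U(1)^n$, such that $\omega_h=\sqrt{-1}F_h$ is a symplectic form, where $F_h$ is the curvature of the Chern connection of $(\mathcal{L}_{\vec c},h)$. For every $\vec b\in\mathbb{Z}^r$ and every $T_{\mathbb{R}}$-invariant real analytic hermitian metric $k$ on $\mathcal{L}_{\vec b}$, let $s_{\vec b}$ be the rational section of $\mathcal{L}_{\vec b}$ with divisor $\sum_i b_iD_i$ (the rational function $1$), put $f_{\vec b,k}(y)=-\log\|s_{\vec b}\|_{k}(\exp y)$ for $y=\sum_j y_je_j\in N_{\mathbb{R}}$, where $\exp y=(e^{y_1},\dots,e^{y_n})\in(\mathbb{C}^*)^n\subset X_\Sigma$, and let $$\mathbb{L}_{\vec b,k}=\Bigl\{\Bigl(\sum_j \frac{\partial f_{\vec b,k}}{\partial y_j}(y)\,e_j^*,\ y\Bigr)\ \Big|\ y\in N_{\mathbb{R}}\Bigr\}\subset T^*M_{\mathbb{R}}.$$ Let $\triangle_{-\vec c}=\{m\in M_{\mathbb{R}}\mid \langle m,v_i\rangle\le c_i,\ i=1,\dots,r\}$. For $q\in M_{\mathbb{R}}$ let $L_q=\{(q,y)\mid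 y\in N_{\mathbb{R}}\}$ be the cotangent fiber at $q$, and for $L\subset T^*M_{\mathbb{R}}$ let $L'$ be the set of points of $L$ off the zero section, i.e. with $y\neq0$. Then for every $q\in\partial\triangle_{-\vec c}$ there exists $\delta>0$ such that for all real $t_1,t_2$ $$0\le t_1\le t_2<\delta\quad\Longrightarrow\quad \gamma_{t_1}(L_q')\cap\gamma_{t_2}(\mathbb{L}_{-\vec c,h^{-1}}')=\emptyset .$$ -/

import Mathlib

noncomputable section

namespace Toric

/-- The lattice `N = ℤⁿ`; its standard basis is `e₁, …, eₙ`. -/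
abbrev Lattice (n : ℕ) : Type := Fin n → ℤ

/-- The dual lattice `M = Hom(N, ℤ)`. -/
abbrev DualLattice (n : ℕ) : Type := Module.Dual ℤ (Lattice n)

/-- `N_ℝ`, with the inner product for which `e₁, …, eₙ` is orthonormal. -/
abbrev NR (n : ℕ) : Type := EuclideanSpace ℝ (Fin n)

/-- `M_ℝ`, in the coordinates of the dual basis `e₁*, …, eₙ*`, which is orthonormal. -/
abbrev MR (n : ℕ) : Type := EuclideanSpace ℝ (Fin n)

/-- The inclusion `N → N_ℝ`. -/
def toReal {n : ℕ} (v : Lattice n) : NR n := WithLp.toLp 2 fun j => (v j : ℝ)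

/-- The natural pairing `M_ℝ × N_ℝ → ℝ`. -/
def pairing {n : ℕ} (m : MR n) (y : NR n) : ℝ := ∑ j, m j * y j

/-- The convex cone in `N_ℝ` generated by the lattice vectors `v i`, `i ∈ S`. -/
def coneOver {n r : ℕ} (v : Fin r → Lattice n) (S : Finset (Fin r)) : Set (NR n) :=
  {y | ∃ a : Fin r → ℝ, (∀ i, 0 ≤ a i) ∧ y = ∑ i ∈ S, a i • toReal (v i)}

/-- A nonsingular complete fan in `N_ℝ` with rays numbered by `Fin r`. The vector `v i` is the
primitive generator of the `i`-th ray, and a cone of the fan is recorded by the set `S` of (the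
indices of) its rays, so that it equals `coneOver v S`. As the cones are simplicial, the faces of
`coneOver v S` are the cones `coneOver v S'` with `S' ⊆ S`. -/
structure SmoothCompleteFan (n r : ℕ) where
  /-- the ray generators -/
  v : Fin r → Lattice n
  /-- the cones, each given by its set of rays -/
  cones : Finset (Finset (Fin r))
  /-- every ray is a cone of the fan -/
  ray_mem : ∀ i, {i} ∈ cones
  /-- a face of a cone of the fan is a cone of the fan -/
  face_mem : ∀ S ∈ cones, ∀ S' ⊆ S, S' ∈ cones
  /-- two cones of the fan meet in a common face -/
  inter : ∀ S ∈ cones, ∀ S' ∈ cones, coneOver v S ∩ coneOver v S' = coneOver v (S ∩ S')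
  /-- nonsingular: the generators of each cone are part of a `ℤ`-basis of `N` -/
  smooth : ∀ S ∈ cones, ∃ (b : Module.Basis (Fin n) ℤ (Lattice n)) (e : S ↪ Fin n),
    ∀ i : S, b (e i) = v i
  /-- complete: the cones cover `N_ℝ` -/
  complete : ∀ y : NR n, ∃ S ∈ cones, y ∈ coneOver v S

namespace SmoothCompleteFan

variable {n r : ℕ} (F : SmoothCompleteFan n r)

/-- `Σ(n)`: the cones of dimension `n`. -/
abbrev MaxCone : Type := {S : Finset (Fin r) // S ∈ F.cones ∧ S.card = n}

theorem nonempty_maxCone : Nonempty F.MaxCone := by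
  by_contra hne
  have hlt : ∀ S ∈ F.cones,
      Submodule.span ℝ (Set.range fun i : S => toReal (F.v i)) ≠ ⊤ := by
    intro S hS htop
    obtain ⟨b, e, -⟩ := F.smooth S hS
    have h1 : S.card ≤ n := by
      simpa using Fintype.card_le_of_injective e e.injective
    have h2 := finrank_range_le_card (R := ℝ) fun i : S => toReal (F.v i)
    rw [Set.finrank, htop, finrank_top] at h2
    simp only [finrank_euclideanSpace, Fintype.card_fin, Fintype.card_coe] at h2
    exact hne ⟨⟨S, hS, le_antisymm h1 h2⟩⟩
  have hcov : (Set.univ : Set (NR n)) ⊆ ⋃ S ∈ F.cones,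
      (Submodule.span ℝ (Set.range fun i : S => toReal (F.v i)) : Set (NR n)) := by
    intro y _
    obtain ⟨S, hS, a, -, rfl⟩ := F.complete y
    refine Set.mem_iUnion₂.2 ⟨S, hS, ?_⟩
    exact Submodule.sum_mem _ fun i hi =>
      Submodule.smul_mem _ _ (Submodule.subset_span ⟨⟨i, hi⟩, rfl⟩)
  have h0 : MeasureTheory.volume (Set.univ : Set (NR n)) = 0 := by
    refine MeasureTheory.measure_mono_null hcov ?_
    refine (MeasureTheory.measure_biUnion_null_iff F.cones.countable_toSet).2 ?_
    intro S hS
    exact MeasureTheory.Measure.addHaar_submodule _ _ (hlt S hS)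
  exact (NeZero.ne (MeasureTheory.volume : MeasureTheory.Measure (NR n)))
    (MeasureTheory.Measure.measure_univ_eq_zero.1 h0)

variable {F}

theorem MaxCone.exists_basis (σ : F.MaxCone) :
    ∃ b : Module.Basis σ.1 ℤ (Lattice n), ∀ i : σ.1, b i = F.v i := by
  obtain ⟨b, e, he⟩ := F.smooth σ.1 σ.2.1
  have hb : Function.Bijective e :=
    (Fintype.bijective_iff_injective_and_card e).2 ⟨e.injective, by simp [σ.2.2]⟩
  exact ⟨b.reindex (Equiv.ofBijective e hb).symm, fun i => by simpa using he i⟩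

/-- The generators of an `n`-dimensional cone, as a `ℤ`-basis of `N`. -/
def MaxCone.basis (σ : F.MaxCone) : Module.Basis σ.1 ℤ (Lattice n) := σ.exists_basis.choose

theorem MaxCone.basis_apply (σ : F.MaxCone) (i : σ.1) : σ.basis i = F.v i :=
  σ.exists_basis.choose_spec i

/-- The vector of the dual `ℤ`-basis of `M` that belongs to the ray `i` of `σ`. -/
def MaxCone.dual (σ : F.MaxCone) (i : σ.1) : DualLattice n := σ.basis.coord i

theorem MaxCone.dual_self (σ : F.MaxCone) (i j : σ.1) :
    σ.dual i (F.v j) = if i = j then 1 else 0 := by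
  rw [MaxCone.dual, ← σ.basis_apply j, Module.Basis.coord_apply, Module.Basis.repr_self,
    Finsupp.single_apply]
  simp only [eq_comm]

theorem MaxCone.sum_dual (σ : F.MaxCone) (m : DualLattice n) (w : Lattice n) :
    ∑ i : σ.1, σ.dual i w * m (F.v i) = m w := by
  conv_rhs => rw [← σ.basis.sum_repr w, map_sum]
  exact Finset.sum_congr rfl fun i _ => by
    rw [map_smul, σ.basis_apply, smul_eq_mul, MaxCone.dual, Module.Basis.coord_apply]

/-- The affine chart `X_σ = Spec ℂ[σ^∨ ∩ M] ≅ ℂⁿ` of the toric variety, with the coordinates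
`Z_i = χ^{w_i^∨}`, where `w_i^∨` is the dual basis of the generators of `σ`. -/
abbrev Chart (σ : F.MaxCone) : Type := σ.1 → ℂ

/-- The value of the character `χ^m` in the chart `X_σ`: it is `∏ Z_i ^ ⟨m, v_i⟩`. -/
def chi (σ : F.MaxCone) (m : DualLattice n) (z : Chart σ) : ℂ := ∏ i : σ.1, z i ^ m (F.v i)

/-- The gluing of the charts: `z ∈ X_σ` and `z' ∈ X_σ'` are the same point if `z` lies in
`X_{σ ∩ σ'} ⊆ X_σ`, where the coordinates of the rays of `σ` outside `σ'` do not vanish, and the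
coordinates of `z'` are the values at `z` of the characters that are the coordinates on `X_σ'`. -/
def Glue (p p' : Σ σ : F.MaxCone, Chart σ) : Prop :=
  (∀ i : p.1.1, (i : Fin r) ∉ p'.1.1 → p.2 i ≠ 0) ∧
    ∀ j : p'.1.1, p'.2 j = chi p.1 (p'.1.dual j) p.2

theorem chi_eq_of_glue {p p' : Σ σ : F.MaxCone, Chart σ} (h : Glue p p') (m : DualLattice n) :
    chi p'.1 m p'.2 = chi p.1 m p.2 := by
  unfold chi
  calc ∏ j, p'.2 j ^ m (F.v j)
      = ∏ j, ∏ i, p.2 i ^ (p'.1.dual j (F.v i) * m (F.v j)) := by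
        refine Finset.prod_congr rfl fun j _ => ?_
        rw [h.2 j, chi, ← Finset.prod_zpow]
        exact Finset.prod_congr rfl fun i _ => (zpow_mul _ _ _).symm
    _ = ∏ i, ∏ j, p.2 i ^ (p'.1.dual j (F.v i) * m (F.v j)) := Finset.prod_comm
    _ = ∏ i, p.2 i ^ m (F.v i) := by
        refine Finset.prod_congr rfl fun i _ => ?_
        by_cases hi : (i : Fin r) ∈ p'.1.1
        · rw [Finset.prod_eq_single ⟨i, hi⟩]
          · rw [p'.1.dual_self ⟨i, hi⟩ ⟨i, hi⟩]; simp
          · intro j _ hj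
            rw [p'.1.dual_self j ⟨i, hi⟩]; simp [hj]
          · simp
        · rw [← p'.1.sum_dual m (F.v i)]
          have h0 := h.1 i hi
          induction (Finset.univ : Finset p'.1.1) using Finset.induction_on with
          | empty => simp
          | insert a s ha ih => rw [Finset.prod_insert ha, Finset.sum_insert ha, zpow_add₀ h0, ih]

theorem chi_dual (σ : F.MaxCone) (j : σ.1) (z : Chart σ) : chi σ (σ.dual j) z = z j := by
  rw [chi, Finset.prod_eq_single j]
  · simp [σ.dual_self]
  · intro i _ hi
    simp [σ.dual_self, hi.symm]
  · simp

theorem glue_refl (p : Σ σ : F.MaxCone, Chart σ) : Glue p p :=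
  ⟨fun i hi => absurd i.2 hi, fun j => (chi_dual p.1 j p.2).symm⟩

theorem glue_symm {p p' : Σ σ : F.MaxCone, Chart σ} (h : Glue p p') : Glue p' p := by
  refine ⟨fun j hj => ?_, fun i => ?_⟩
  · rw [h.2 j, chi, Finset.prod_ne_zero_iff]
    intro i _
    by_cases hi : (i : Fin r) ∈ p'.1.1
    · have hji : j ≠ ⟨i, hi⟩ := fun e => hj (by rw [e]; exact i.2)
      rw [p'.1.dual_self j ⟨i, hi⟩]; simp [hji]
    · exact zpow_ne_zero _ (h.1 i hi)
  · rw [chi_eq_of_glue h, chi_dual]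

theorem glue_trans {p p' p'' : Σ σ : F.MaxCone, Chart σ} (h : Glue p p') (h' : Glue p' p'') :
    Glue p p'' := by
  refine ⟨fun i hi => ?_, fun j => ?_⟩
  · by_cases hi' : (i : Fin r) ∈ p'.1.1
    · intro h0
      refine h'.1 ⟨i, hi'⟩ hi ?_
      rw [h.2, chi]
      refine Finset.prod_eq_zero (Finset.mem_univ i) ?_
      rw [p'.1.dual_self ⟨i, hi'⟩ ⟨i, hi'⟩]; simp [h0]
    · exact h.1 i hi'
  · rw [h'.2 j, chi_eq_of_glue h]

variable (F) in
/-- The identification of points in different charts. -/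
def glueSetoid : Setoid (Σ σ : F.MaxCone, Chart σ) :=
  ⟨Glue, glue_refl, glue_symm, glue_trans⟩

variable (F) in
/-- The (closed points of the) toric variety `X_Σ`, glued from the charts `X_σ`, `σ ∈ Σ(n)`. -/
def Variety : Type := Quotient F.glueSetoid

/-- The point of `X_Σ` with coordinates `z` in the chart `X_σ`. -/
def point (σ : F.MaxCone) (z : Chart σ) : F.Variety := Quotient.mk F.glueSetoid ⟨σ, z⟩

/-- The character `m_σ ∈ M` with `⟨m_σ, v_i⟩ = -c_i` for all rays `i` of `σ`. The line bundle
`𝓛_c = 𝒪(∑ c_i D_i)` is trivialised over `X_σ` by the frame `e_σ = χ^{m_σ} s_c`, where `s_c` is the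
rational section with divisor `∑ c_i D_i` (the rational function `1`). -/
def localCharacter (σ : F.MaxCone) (c : Fin r → ℤ) : DualLattice n :=
  -∑ i : σ.1, c i • σ.dual i

/-- The transition function of `𝓛_c`, in the coordinates of `X_σ`: on `X_σ ∩ X_σ'` one has
`e_σ = transition c σ σ' • e_σ'`. -/
def transition (c : Fin r → ℤ) (σ σ' : F.MaxCone) (z : Chart σ) : ℂ :=
  chi σ (localCharacter σ c - localCharacter σ' c) z

/-- A family of polynomials `g_σ ∈ ℂ[X_σ]` is a global regular section of `𝓛_c` if the local
sections `g_σ e_σ` agree on the overlaps of the charts. -/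
def IsGlobalSection (c : Fin r → ℤ) (g : ∀ σ : F.MaxCone, MvPolynomial σ.1 ℂ) : Prop :=
  ∀ (σ σ' : F.MaxCone) (z : Chart σ) (z' : Chart σ'), point σ z = point σ' z' →
    MvPolynomial.eval z' (g σ') = MvPolynomial.eval z (g σ) * transition c σ σ' z

variable (F) in
/-- `𝓛_c` is very ample: its global sections have no common zero, separate points and separate
tangent vectors, so that they embed the complete variety `X_Σ` into a projective space. -/
def IsVeryAmple (c : Fin r → ℤ) : Prop :=
  (∀ (σ : F.MaxCone) (z : Chart σ), ∃ g : ∀ σ : F.MaxCone, MvPolynomial σ.1 ℂ,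
    IsGlobalSection c g ∧ MvPolynomial.eval z (g σ) ≠ 0) ∧
  (∀ (σ σ' : F.MaxCone) (z : Chart σ) (z' : Chart σ'), point σ z ≠ point σ' z' →
    ∃ g : ∀ σ : F.MaxCone, MvPolynomial σ.1 ℂ, IsGlobalSection c g ∧
      MvPolynomial.eval z (g σ) = 0 ∧ MvPolynomial.eval z' (g σ') ≠ 0) ∧
  (∀ (σ : F.MaxCone) (z ξ : Chart σ), ξ ≠ 0 →
    ∃ g : ∀ σ : F.MaxCone, MvPolynomial σ.1 ℂ, IsGlobalSection c g ∧
      MvPolynomial.eval z (g σ) = 0 ∧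
      ∑ i, MvPolynomial.eval z (MvPolynomial.pderiv i (g σ)) * ξ i ≠ 0)

variable (F) in
/-- `𝓛_c` is ample: some positive tensor power `𝓛_c^{⊗ k} = 𝓛_{k c}` is very ample. -/
def IsAmple (c : Fin r → ℤ) : Prop := ∃ k : ℕ, 0 < k ∧ F.IsVeryAmple (k • c)

/-- The coordinates in the chart `X_σ` of a point `t` of the torus `T = (ℂ^*)ⁿ`, the open orbit
(meaningful if all `t j` are nonzero). -/
def torusCoord (σ : F.MaxCone) (t : Fin n → ℂ) : Chart σ :=
  fun i => ∏ j, t j ^ σ.dual i (Pi.single j 1)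

theorem torusCoord_ne_zero (t : Fin n → ℂ) (ht : ∀ j, t j ≠ 0) (σ : F.MaxCone) (i : σ.1) :
    torusCoord σ t i ≠ 0 :=
  Finset.prod_ne_zero_iff.2 fun j _ => zpow_ne_zero _ (ht j)

theorem chi_torusCoord (t : Fin n → ℂ) (ht : ∀ j, t j ≠ 0) (σ : F.MaxCone) (m : DualLattice n) :
    chi σ m (torusCoord σ t) = ∏ j, t j ^ m (Pi.single j 1) := by
  unfold chi torusCoord
  simp_rw [← Finset.prod_zpow, ← zpow_mul]
  rw [Finset.prod_comm]
  refine Finset.prod_congr rfl fun j _ => ?_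
  rw [← σ.sum_dual m (Pi.single j 1)]
  induction (Finset.univ : Finset σ.1) using Finset.induction_on with
  | empty => simp
  | insert a s ha ih => rw [Finset.prod_insert ha, Finset.sum_insert ha, zpow_add₀ (ht j), ih]

theorem glue_torusCoord (t : Fin n → ℂ) (ht : ∀ j, t j ≠ 0) (σ σ' : F.MaxCone) :
    Glue ⟨σ, torusCoord σ t⟩ ⟨σ', torusCoord σ' t⟩ :=
  ⟨fun i _ => torusCoord_ne_zero t ht σ i, fun j => (chi_torusCoord t ht σ (σ'.dual j)).symm⟩

variable (F) in
/-- A `T_ℝ`-invariant, real analytic hermitian metric `h` on `𝓛_c`, given by the functions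
`h_σ = ‖e_σ‖²` on the charts `X_σ`. An element `t` of `T_ℝ = U(1)ⁿ` acts on `X_σ` by
multiplication with its coordinates; it fixes `s_c` and multiplies `e_σ` by a number of modulus
one, so that invariance of `h` means invariance of `h_σ`. -/
@[ext]
structure HermitianMetric (c : Fin r → ℤ) where
  /-- the function `h_σ = ‖e_σ‖²` -/
  weight : ∀ σ : F.MaxCone, Chart σ → ℝ
  pos : ∀ (σ : F.MaxCone) (z : Chart σ), 0 < weight σ z
  compat : ∀ (σ σ' : F.MaxCone) (z : Chart σ) (z' : Chart σ'), point σ z = point σ' z' →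
    weight σ z = ‖transition c σ σ' z‖ ^ 2 * weight σ' z'
  analytic : ∀ σ : F.MaxCone, AnalyticOnNhd ℝ (weight σ) Set.univ
  invariant : ∀ (t : Fin n → ℂ), (∀ j, ‖t j‖ = 1) → ∀ (σ : F.MaxCone) (z : Chart σ),
    weight σ (torusCoord σ t * z) = weight σ z

theorem transition_neg (c : Fin r → ℤ) (σ σ' : F.MaxCone) (z : Chart σ) :
    transition (-c) σ σ' z = (transition c σ σ' z)⁻¹ := by
  have h : ∀ τ : F.MaxCone, localCharacter τ (-c) = -localCharacter τ c := by
    intro τ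
    simp [localCharacter]
  rw [transition, transition, h, h, neg_sub_neg, ← neg_sub, chi, chi, ← Finset.prod_inv_distrib]
  exact Finset.prod_congr rfl fun i _ => by rw [LinearMap.neg_apply, zpow_neg]

namespace HermitianMetric

variable {c : Fin r → ℤ} (h : F.HermitianMetric c)

/-- The metric `h⁻¹` on `𝓛_c⁻¹ = 𝓛_{-c}`. -/
def inv : F.HermitianMetric (-c) where
  weight σ z := (h.weight σ z)⁻¹
  pos σ z := inv_pos.2 (h.pos σ z)
  compat σ σ' z z' hz := by
    rw [h.compat σ σ' z z' hz, transition_neg, norm_inv, inv_pow, mul_inv]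
  analytic σ := (h.analytic σ).inv fun z _ => (h.pos σ z).ne'
  invariant t ht σ z := by rw [h.invariant t ht]

/-- The connection form `∂ log h_σ` of the Chern connection of `(𝓛_c, h)` in the holomorphic frame
`e_σ`, where `∂u(ξ) = (du(ξ) - √-1 du(√-1 ξ)) / 2`. -/
def connectionForm (σ : F.MaxCone) (z ξ : Chart σ) : ℂ :=
  ((fderiv ℝ (fun w => Real.log (h.weight σ w)) z ξ : ℝ) -
    Complex.I * (fderiv ℝ (fun w => Real.log (h.weight σ w)) z (Complex.I • ξ) : ℝ)) / 2

/-- The curvature `F_h`, the exterior derivative of the connection form, in the chart `X_σ`. -/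
def curvature (σ : F.MaxCone) (z ξ η : Chart σ) : ℂ :=
  fderiv ℝ (fun w => h.connectionForm σ w η) z ξ - fderiv ℝ (fun w => h.connectionForm σ w ξ) z η

/-- The (real, closed) 2-form `ω_h = √-1 F_h`, in the chart `X_σ`. -/
def omega (σ : F.MaxCone) (z ξ η : Chart σ) : ℂ := Complex.I * h.curvature σ z ξ η

/-- `ω_h` is a symplectic form: being closed, it only has to be nondegenerate at every point. -/
def IsSymplectic : Prop :=
  ∀ (σ : F.MaxCone) (z ξ : Chart σ), (∀ η : Chart σ, h.omega σ z ξ η = 0) → ξ = 0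

/-- The norm `‖s_c‖_h` at a point `t` of the open orbit `T`, computed in some chart `X_σ`, where
`s_c = (∏ Z_i ^ c_i) e_σ`. -/
def sectionNorm (t : Fin n → ℂ) : ℝ :=
  let σ : F.MaxCone := Classical.choice F.nonempty_maxCone
  ‖∏ i : σ.1, torusCoord σ t i ^ c i‖ * √(h.weight σ (torusCoord σ t))

/-- The norm `‖s_c‖_h` on the open orbit does not depend on the chart. -/
theorem sectionNorm_eq (t : Fin n → ℂ) (ht : ∀ j, t j ≠ 0) (σ : F.MaxCone) :
    h.sectionNorm t =
      ‖∏ i : σ.1, torusCoord σ t i ^ c i‖ * √(h.weight σ (torusCoord σ t)) := by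
  have key : ∀ σ : F.MaxCone, ‖∏ i : σ.1, torusCoord σ t i ^ c i‖ =
      ‖chi σ (localCharacter σ c) (torusCoord σ t)‖⁻¹ := by
    intro σ
    rw [chi, ← norm_inv, ← Finset.prod_inv_distrib]
    congr 1
    refine Finset.prod_congr rfl fun i _ => ?_
    rw [← zpow_neg]
    congr 1
    simp only [localCharacter, LinearMap.neg_apply, LinearMap.sum_apply, LinearMap.smul_apply,
      neg_neg, smul_eq_mul, σ.dual_self]
    simp
  set τ : F.MaxCone := Classical.choice F.nonempty_maxCone with hτ
  have hglue := glue_torusCoord t ht τ σ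
  have hc := h.compat τ σ _ _ (Quotient.sound hglue)
  have hne : ∀ (σ : F.MaxCone) (m : DualLattice n), chi σ m (torusCoord σ t) ≠ 0 := fun σ m =>
    Finset.prod_ne_zero_iff.2 fun i _ => zpow_ne_zero _ (torusCoord_ne_zero t ht σ i)
  have hsub : transition c τ σ (torusCoord τ t) =
      chi τ (localCharacter τ c) (torusCoord τ t) / chi σ (localCharacter σ c) (torusCoord σ t) := by
    rw [chi_eq_of_glue hglue, transition, chi, chi, chi, ← Finset.prod_div_distrib]
    exact Finset.prod_congr rfl fun i _ => by
      rw [LinearMap.sub_apply, zpow_sub₀ (torusCoord_ne_zero t ht τ i)]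
  have h1 := norm_ne_zero_iff.2 (hne τ (localCharacter τ c))
  rw [sectionNorm, ← hτ]
  rw [key τ, key σ, hc, Real.sqrt_mul (sq_nonneg _), Real.sqrt_sq (norm_nonneg _), hsub, norm_div]
  field_simp

/-- The function `f_{c,h}(y) = -log ‖s_c‖_h` on `N_ℝ`, evaluated at `exp y ∈ T`. -/
def potential (y : NR n) : ℝ := -Real.log (h.sectionNorm fun j => (Real.exp (y j) : ℂ))

/-- The map `Φ_{c,h} ∘ j₀ : N_ℝ → M_ℝ`, with coordinates `∂f_{c,h}/∂y_j`. -/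
def momentMap (y : NR n) : MR n :=
  WithLp.toLp 2 fun j => fderiv ℝ h.potential y (EuclideanSpace.single j 1)

/-- The T-dual Lagrangian `𝕃_{c,h}` in `T^*M_ℝ = M_ℝ × N_ℝ`. -/
def tDual : Set (MR n × NR n) := {p | p.1 = h.momentMap p.2}

end HermitianMetric

variable (F) in
/-- The polytope `Δ_c = {m ∈ M_ℝ | ⟨m, v_i⟩ ≥ -c_i for all i}`. -/
def polytope (c : Fin r → ℤ) : Set (MR n) := {m | ∀ i, -(c i : ℝ) ≤ pairing m (toReal (F.v i))}

variable (F) in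
/-- The polytope `Δ_{-c} = -Δ_c = {m ∈ M_ℝ | ⟨m, v_i⟩ ≤ c_i for all i}` of the anti-ample line
bundle `𝓛_{-c}`, where `𝓛_c` is ample. -/
def negPolytope (c : Fin r → ℤ) : Set (MR n) := {m | -m ∈ F.polytope c}

end SmoothCompleteFan

/-- The isometry `N_ℝ → M_ℝ`, `e_j ↦ e_j^*`, `y ↦ y^*`. -/
def dualIso (n : ℕ) : NR n ≃ₗᵢ[ℝ] MR n := LinearIsometryEquiv.refl ℝ (EuclideanSpace ℝ (Fin n))

/-- The complement of the zero section in a subset of `T^*M_ℝ = M_ℝ × N_ℝ`. -/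
def offZeroSection {n : ℕ} (L : Set (MR n × NR n)) : Set (MR n × NR n) := {p ∈ L | p.2 ≠ 0}

/-- The normalized geodesic flow `γ_t(x, y) = (x + t y^* / |y^*|, y)`; it is only used off the zero
section. -/
def geodesicFlow {n : ℕ} (t : ℝ) (p : MR n × NR n) : MR n × NR n :=
  (p.1 + (t / ‖dualIso n p.2‖) • dualIso n p.2, p.2)

/-- The cotangent fibre `L_q = {(q, y) | y ∈ N_ℝ}`. -/
def cotangentFiber {n : ℕ} (q : MR n) : Set (MR n × NR n) := {p | p.1 = q}

end Toric

end

/-! Write Φ for the moment map `h.inv.momentMap`. The flow fixes y, so a common point of the two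
flowed sets means q - Φ(y) = t y/|y| with t = t₂ - t₁ and y ≠ 0. It suffices to exclude this for all
small t ≥ 0, which is `exists_gap_of_mem_frontier`.

Two facts carry the argument. First, Φ maps into the open polytope: ⟨Φ(y), v_i⟩ < c_i for every ray
(`pairing_inv_momentMap_lt`). Second, in a chart X_σ the function ⟨Φ, v_j⟩ extends continuously over
the divisor Z_j = 0, where it equals c_j (`pairing_inv_momentMap_ray`, `radialDeriv_eq_zero`).

If the gap failed, there would be y_k and t_k → 0 with q - Φ(y_k) = t_k y_k/|y_k|, so Φ(y_k) → q.
Pass to a limit in a chart with y_k ∈ -σ. The limit is not in the open orbit, since q is a boundary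
point, so some chart coordinates tend to 0; let S be the set of their rays. For j ∈ S the second
fact gives ⟨q, v_j⟩ = c_j, and the first then gives ⟨y_k, v_j⟩ > 0. But the S-part of y_k is a
nonpositive combination of these v_j, and the rest of y_k is bounded; hence the S-part is bounded
too (`norm_sum_le_of_inner_nonneg`), a contradiction.

The first fact needs the potential to be strictly concave, that is, ω_h positive and not merely
nondegenerate. The sign comes from a maximum principle: the norm of χ^q is continuous on the compact
variety because q lies in the polytope, and at its maximum the Levi form is semidefinite, since the
terms log |Z_j| are pluriharmonic. Nondegeneracy spreads definiteness over the connected chart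
(`exists_leviForm_pos`). -/

noncomputable section

namespace Toric

open Filter Topology

/-! ### Maximal cones and their linear coordinates -/

namespace SmoothCompleteFan

variable {n r : ℕ} {F : SmoothCompleteFan n r}

/-- The coordinate of `y ∈ N_ℝ` along the ray `j` of the maximal cone `σ`. -/
def MaxCone.coord (σ : F.MaxCone) (j : σ.1) : NR n →L[ℝ] ℝ :=
  ∑ l, (σ.dual j (Pi.single l 1) : ℝ) • EuclideanSpace.proj l

theorem MaxCone.coord_apply (σ : F.MaxCone) (j : σ.1) (y : NR n) :
    σ.coord j y = ∑ l, (σ.dual j (Pi.single l 1) : ℝ) * y l := by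
  simp [MaxCone.coord]

theorem dualLattice_apply_eq_sum (m : DualLattice n) (w : Lattice n) :
    m w = ∑ l, m (Pi.single l 1) * w l := by
  conv_lhs => rw [← Finset.univ_sum_single w, map_sum]
  refine Finset.sum_congr rfl fun l _ => ?_
  have : (Pi.single l (w l) : Lattice n) = w l • Pi.single l 1 := by
    rw [← Pi.single_smul, smul_eq_mul, mul_one]
  rw [this, map_smul, smul_eq_mul, mul_comm]

theorem MaxCone.coord_toReal (σ : F.MaxCone) (j k : σ.1) :
    σ.coord j (toReal (F.v k)) = if j = k then 1 else 0 := by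
  have h := dualLattice_apply_eq_sum (σ.dual j) (F.v k)
  rw [σ.dual_self] at h
  rw [σ.coord_apply]
  simp only [toReal]
  exact_mod_cast h.symm

theorem MaxCone.sum_coord (σ : F.MaxCone) (y : NR n) :
    ∑ j : σ.1, σ.coord j y • toReal (F.v j) = y := by
  ext i
  simp only [WithLp.ofLp_sum, Finset.sum_apply, PiLp.smul_apply, smul_eq_mul, σ.coord_apply, toReal]
  simp_rw [Finset.sum_mul]
  rw [Finset.sum_comm]
  have key : ∀ l, ∑ j : σ.1, (σ.dual j (Pi.single l 1) : ℝ) * y l * (F.v j i : ℝ) =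
      (if i = l then 1 else 0) * y l := by
    intro l
    have h := σ.sum_dual (LinearMap.proj i) (Pi.single l 1)
    simp only [LinearMap.proj_apply, Pi.single_apply] at h
    have h' : ∑ j : σ.1, (σ.dual j (Pi.single l 1) : ℝ) * (F.v j i : ℝ) =
        (if i = l then 1 else 0) := by
      simpa [Pi.single_apply] using congrArg (fun x : ℤ => (x : ℝ)) h
    rw [← h', Finset.sum_mul]
    exact Finset.sum_congr rfl fun j _ => by ring
  simp_rw [key]
  simp

theorem MaxCone.mem_coneOver_iff (σ : F.MaxCone) (y : NR n) :
    y ∈ coneOver F.v σ.1 ↔ ∀ j, 0 ≤ σ.coord j y := by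
  constructor
  · rintro ⟨a, ha, rfl⟩ j
    rw [map_sum]
    refine Finset.sum_nonneg fun k hk => ?_
    rw [map_smul, σ.coord_toReal j ⟨k, hk⟩, smul_eq_mul]
    refine mul_nonneg (ha k) ?_
    split_ifs <;> simp
  · intro h
    refine ⟨fun i => if hi : i ∈ σ.1 then σ.coord ⟨i, hi⟩ y else 0, fun i => ?_, ?_⟩
    · dsimp only
      split_ifs with hi
      · exact h _
      · exact le_rfl
    · conv_lhs => rw [← σ.sum_coord y]
      rw [← Finset.sum_coe_sort σ.1]
      exact Finset.sum_congr rfl fun i _ => by simp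

theorem MaxCone.isClosed_coneOver (σ : F.MaxCone) : IsClosed (coneOver F.v σ.1) := by
  have : coneOver F.v σ.1 = ⋂ j, {y | 0 ≤ σ.coord j y} := by
    ext y; simp [σ.mem_coneOver_iff]
  rw [this]
  exact isClosed_iInter fun j => isClosed_le continuous_const (σ.coord j).continuous

theorem volume_coneOver_eq_zero {S : Finset (Fin r)} (hcard : S.card < n) :
    MeasureTheory.volume (coneOver F.v S) = 0 := by
  have hlt : Submodule.span ℝ (Set.range fun i : S => toReal (F.v i)) ≠ ⊤ := by
    intro htop
    have h2 := finrank_range_le_card (R := ℝ) fun i : S => toReal (F.v i)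
    rw [Set.finrank, htop, finrank_top] at h2
    simp only [finrank_euclideanSpace, Fintype.card_fin, Fintype.card_coe] at h2
    omega
  refine MeasureTheory.measure_mono_null ?_ (MeasureTheory.Measure.addHaar_submodule _ _ hlt)
  rintro y ⟨a, -, rfl⟩
  exact Submodule.sum_mem _ fun i hi =>
    Submodule.smul_mem _ _ (Submodule.subset_span ⟨⟨i, hi⟩, rfl⟩)

theorem card_le_of_mem_cones {S : Finset (Fin r)} (hS : S ∈ F.cones) : S.card ≤ n := by
  obtain ⟨b, e, -⟩ := F.smooth S hS
  simpa using Fintype.card_le_of_injective e e.injective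

variable (F) in
/-- The maximal cones of a complete fan cover `N_ℝ`. -/
theorem exists_maxCone_mem (y : NR n) : ∃ σ : F.MaxCone, y ∈ coneOver F.v σ.1 := by
  -- The uncovered set is open, yet it lies in finitely many cones of lower dimension, which are
  -- null sets.
  set U : Set (NR n) := (⋃ σ : F.MaxCone, coneOver F.v σ.1)ᶜ with hU
  have hopen : IsOpen U :=
    (isClosed_iUnion_of_finite fun σ : F.MaxCone => σ.isClosed_coneOver).isOpen_compl
  have hsub : U ⊆ ⋃ S ∈ F.cones.filter (fun S => S.card < n), coneOver F.v S := by
    intro x hx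
    obtain ⟨S, hS, hxS⟩ := F.complete x
    refine Set.mem_iUnion₂.2 ⟨S, Finset.mem_filter.2 ⟨hS, ?_⟩, hxS⟩
    refine lt_of_le_of_ne (card_le_of_mem_cones hS) fun hc => hx ?_
    exact Set.mem_iUnion.2 ⟨⟨S, hS, hc⟩, hxS⟩
  have h0 : MeasureTheory.volume U = 0 := by
    refine MeasureTheory.measure_mono_null hsub ?_
    refine (MeasureTheory.measure_biUnion_null_iff (Finset.countable_toSet _)).2 ?_
    intro S hS
    exact volume_coneOver_eq_zero (Finset.mem_filter.1 hS).2
  have hempty := (hopen.measure_eq_zero_iff _).1 h0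
  by_contra hne
  have : y ∈ U := by
    rw [hU, Set.mem_compl_iff, Set.mem_iUnion]
    exact hne
  rw [hempty] at this
  exact this

variable (F) in
theorem v_ne_zero (i : Fin r) : toReal (F.v i) ≠ 0 := by
  obtain ⟨b, e, he⟩ := F.smooth {i} (F.ray_mem i)
  have hne := b.ne_zero (e ⟨i, Finset.mem_singleton_self i⟩)
  rw [he] at hne
  intro h
  refine hne (funext fun j => ?_)
  have := congrArg (fun w : NR n => w j) h
  simpa [toReal] using this

variable (F) in
/-- Every ray of a complete fan lies in a maximal cone. -/
theorem exists_maxCone_ray_mem (i : Fin r) : ∃ σ : F.MaxCone, i ∈ σ.1 := by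
  obtain ⟨σ, hσ⟩ := F.exists_maxCone_mem (toReal (F.v i))
  refine ⟨σ, ?_⟩
  by_contra hi
  -- Otherwise the ray would meet σ only in the cone over ∅, which is {0}.
  have hmem : toReal (F.v i) ∈ coneOver F.v {i} ∩ coneOver F.v σ.1 :=
    ⟨⟨fun _ => 1, fun _ => zero_le_one, by simp⟩, hσ⟩
  rw [F.inter _ (F.ray_mem i) _ σ.2.1, Finset.singleton_inter_of_notMem hi] at hmem
  obtain ⟨a, -, ha⟩ := hmem
  exact F.v_ne_zero i (by simpa using ha)

/-! ### Exponential chart coordinates and the potential -/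

/-- The torus point `exp Y` has the chart coordinates `exp` of the coordinates of `Y`. -/
theorem torusCoord_exp (σ : F.MaxCone) (Y : Fin n → ℂ) (j : σ.1) :
    torusCoord σ (fun l => Complex.exp (Y l)) j =
      Complex.exp (∑ l, (σ.dual j (Pi.single l 1) : ℂ) * Y l) := by
  rw [torusCoord, Complex.exp_sum]
  exact Finset.prod_congr rfl fun l _ => by rw [Complex.exp_int_mul]

/-- The chart coordinates of `exp y` for `y ∈ N_ℝ`. -/
def expCoord (σ : F.MaxCone) (y : NR n) : Chart σ := fun j => (Real.exp (σ.coord j y) : ℂ)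

theorem torusCoord_real_exp (σ : F.MaxCone) (y : NR n) :
    torusCoord σ (fun l => (Real.exp (y l) : ℂ)) = expCoord σ y := by
  funext j
  have := torusCoord_exp σ (fun l => (y l : ℂ)) j
  simp only [Complex.ofReal_exp, expCoord, this, σ.coord_apply]
  push_cast
  rfl

theorem MaxCone.coord_sum_smul (σ : F.MaxCone) (τ : σ.1 → ℝ) (j : σ.1) :
    σ.coord j (∑ k, τ k • toReal (F.v k)) = τ j := by
  simp [map_sum, σ.coord_toReal]

/-- Every torus element of modulus one in the chart comes from `T_ℝ`. -/
theorem exists_torusCoord_eq_exp_mul_I (σ : F.MaxCone) (τ : σ.1 → ℝ) :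
    ∃ t : Fin n → ℂ, (∀ l, ‖t l‖ = 1) ∧
      torusCoord σ t = fun j => Complex.exp (τ j * Complex.I) := by
  set y : NR n := ∑ k, τ k • toReal (F.v k)
  refine ⟨fun l => Complex.exp (y l * Complex.I), fun l => Complex.norm_exp_ofReal_mul_I _, ?_⟩
  funext j
  rw [torusCoord_exp, ← σ.coord_sum_smul τ j, σ.coord_apply]
  push_cast
  rw [Finset.sum_mul]
  simp only [mul_assoc]
  rfl

namespace HermitianMetric

variable {c : Fin r → ℤ} (h : F.HermitianMetric c)

/-- The function `log h_σ` on the chart. -/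
def logWeight (σ : F.MaxCone) (z : Chart σ) : ℝ := Real.log (h.weight σ z)

theorem contDiff_logWeight (σ : F.MaxCone) : ContDiff ℝ 2 (h.logWeight σ) :=
  (AnalyticOnNhd.contDiff (h.analytic σ)).log fun z => (h.pos σ z).ne'

theorem logWeight_invariant (σ : F.MaxCone) (τ : σ.1 → ℝ) (z : Chart σ) :
    h.logWeight σ (fun j => z j * Complex.exp (τ j * Complex.I)) = h.logWeight σ z := by
  obtain ⟨t, ht, he⟩ := exists_torusCoord_eq_exp_mul_I σ τ
  have := h.invariant t ht σ z
  rw [he] at this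
  rw [logWeight, logWeight, ← this]
  congr 2
  funext j
  simp [mul_comm]

/-- In the frame of X_σ the section is ∏ Z_j^(-c_j), and the weight of h⁻¹ is the inverse of h_σ.
The second term is smooth on the whole chart, so only the linear term is singular at the boundary
divisors. -/
theorem inv_potential_eq (σ : F.MaxCone) (y : NR n) :
    h.inv.potential y =
      ∑ j : σ.1, (c j : ℝ) * σ.coord j y + h.logWeight σ (expCoord σ y) / 2 := by
  have ht : ∀ l, ((Real.exp (y l) : ℝ) : ℂ) ≠ 0 := fun l => by
    exact_mod_cast (Real.exp_pos _).ne'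
  rw [potential, h.inv.sectionNorm_eq _ ht σ, torusCoord_real_exp]
  have hw := h.pos σ (expCoord σ y)
  have hprod : ‖∏ i : σ.1, expCoord σ y i ^ (-c) i‖ =
      Real.exp (-∑ j : σ.1, (c j : ℝ) * σ.coord j y) := by
    rw [norm_prod, ← Finset.sum_neg_distrib, Real.exp_sum]
    refine Finset.prod_congr rfl fun j _ => ?_
    rw [norm_zpow, expCoord, Complex.norm_real, Real.norm_of_nonneg (Real.exp_pos _).le,
      ← Real.rpow_intCast, ← Real.exp_mul]
    simp [mul_comm]
  rw [hprod, Real.log_mul (Real.exp_pos _).ne' (Real.sqrt_pos.2 (h.inv.pos _ _)).ne',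
    Real.log_exp]
  change -(-_ + Real.log √((h.weight σ (expCoord σ y))⁻¹)) = _
  rw [Real.log_sqrt (inv_pos.2 hw).le, Real.log_inv, logWeight]
  ring

end HermitianMetric
end SmoothCompleteFan

/-! ### Definiteness by continuity and the second derivative test -/

/-- A continuous family of nondegenerate symmetric bilinear forms over a connected space is
positive definite everywhere if it is positive semidefinite at one point. -/
theorem bilinForm_pos_of_preconnectedSpace {X E : Type*} [TopologicalSpace X] [PreconnectedSpace X]
    [NormedAddCommGroup E] [NormedSpace ℝ E] [FiniteDimensional ℝ E]
    (B : X → LinearMap.BilinForm ℝ E) (hcont : Continuous fun p : X × E => B p.1 p.2 p.2)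
    (hsymm : ∀ x ξ η, B x ξ η = B x η ξ) (hnd : ∀ x ξ, (∀ η, B x ξ η = 0) → ξ = 0)
    (x₀ : X) (h₀ : ∀ ξ, 0 ≤ B x₀ ξ ξ) (x : X) (ξ : E) (hξ : ξ ≠ 0) : 0 < B x ξ ξ := by
  -- Cauchy–Schwarz for a semidefinite form: an isotropic vector lies in the radical.
  have hpd : ∀ x, (∀ ξ, 0 ≤ B x ξ ξ) → ∀ ξ, ξ ≠ 0 → 0 < B x ξ ξ := by
    intro x hx ξ hξ
    refine lt_of_le_of_ne (hx ξ) fun h0 => hξ (hnd x ξ fun η => ?_)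
    have := (B x).apply_sq_le_of_symm hx ⟨hsymm x⟩ ξ η
    rw [← h0, zero_mul] at this
    exact pow_eq_zero_iff two_ne_zero |>.1 (le_antisymm this (sq_nonneg _))
  have hclosed : IsClosed {x | ∀ ξ, 0 ≤ B x ξ ξ} := by
    rw [Set.ofPred_forall]
    refine isClosed_iInter fun ξ => isClosed_le continuous_const ?_
    exact hcont.comp (continuous_id.prodMk continuous_const)
  have hopen : IsOpen {x | ∀ ξ, 0 ≤ B x ξ ξ} := by
    rw [isOpen_iff_mem_nhds]
    intro x hx
    -- Openness: positivity on the compact unit sphere persists nearby, and homogeneity extends it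
    -- to all vectors.
    have hev : ∀ᶠ y in 𝓝 x, ∀ ξ ∈ Metric.sphere (0 : E) 1, 0 < B y ξ ξ := by
      refine (isCompact_sphere (0 : E) 1).eventually_forall_of_forall_eventually fun ξ hξ => ?_
      exact hcont.continuousAt.eventually_const_lt
        (hpd x hx ξ (ne_zero_of_mem_unit_sphere ⟨ξ, hξ⟩))
    filter_upwards [hev] with y hy ξ
    rcases eq_or_ne ξ 0 with rfl | hξ
    · simp
    have hn := norm_ne_zero_iff.2 hξ
    have h1 := hy (‖ξ‖⁻¹ • ξ) (by simp [norm_smul, hn])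
    have h2 : B y ξ ξ = ‖ξ‖ ^ 2 * B y (‖ξ‖⁻¹ • ξ) (‖ξ‖⁻¹ • ξ) := by
      simp only [map_smul, LinearMap.smul_apply, smul_eq_mul]
      field_simp
    rw [h2]
    positivity
  have huniv : {x | ∀ ξ, 0 ≤ B x ξ ξ} = Set.univ :=
    IsClopen.eq_univ ⟨hclosed, hopen⟩ ⟨x₀, h₀⟩
  exact hpd x (by have := Set.mem_univ x; rwa [← huniv] at this) ξ hξ

/-- A positive second derivative would make x a local minimum as well, so f would be locally
constant. -/
theorem second_deriv_nonpos_of_isLocalMax {f f' : ℝ → ℝ} {x d : ℝ} (hmax : IsLocalMax f x)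
    (hf : ∀ s, HasDerivAt f (f' s) s) (hf' : HasDerivAt f' d x) : d ≤ 0 := by
  by_contra! hd
  have hderiv : deriv f = f' := funext fun s => (hf s).deriv
  have hmin : IsLocalMin f x := by
    refine isLocalMin_of_deriv_deriv_pos ?_ hmax.deriv_eq_zero (hf x).continuousAt
    rwa [hderiv, hf'.deriv]
  have hconst : f =ᶠ[𝓝 x] fun _ => f x := by
    filter_upwards [hmax, hmin] with s h1 h2 using le_antisymm h1 h2
  have h0 : deriv (deriv f) x = 0 := by
    rw [hconst.deriv.deriv_eq]
    simp
  rw [hderiv, hf'.deriv] at h0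
  exact hd.ne' h0

/-! ### Levi forms along exponential curves -/

section ExpLine

variable {ι : Type*}

/-- The curve `z_j exp (s a_j) + s b_j`. -/
def expLine (z a b : ι → ℂ) (s : ℝ) : ι → ℂ := fun j => z j * Complex.exp (s * a j) + s * b j

theorem expLine_zero (z a b : ι → ℂ) : expLine z a b 0 = z := by
  funext j; simp [expLine]

theorem hasDerivAt_mul_exp_add (z a b : ℂ) (s : ℝ) :
    HasDerivAt (fun s : ℝ => z * Complex.exp (s * a) + s * b)
      (z * a * Complex.exp (s * a) + b) s := by
  have h1 : HasDerivAt (fun s : ℝ => (s : ℂ)) 1 s := Complex.ofRealCLM.hasDerivAt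
  exact ((((h1.mul_const a).cexp).const_mul z).add (h1.mul_const b)).congr_deriv (by ring)

theorem hasDerivAt_expLine (z a b : ι → ℂ) (s : ℝ) :
    HasDerivAt (expLine z a b) (expLine (z * a) a 0 s + b) s := by
  rw [hasDerivAt_pi]
  intro j
  simpa [expLine] using hasDerivAt_mul_exp_add (z j) (a j) (b j) s

theorem mul_I_smul_mul_I_smul (z a : ι → ℂ) :
    z * Complex.I • a * Complex.I • a = -(z * a * a) := by
  funext j
  simp only [Pi.mul_apply, Pi.smul_apply, smul_eq_mul, Pi.neg_apply]
  linear_combination (z j * a j * a j) * Complex.I_sq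

/-- The symmetric bilinear form associated with the `(1,1)`-form `-√-1 ∂∂̄ u`. -/
def leviForm (u : (ι → ℂ) → ℝ) (z : ι → ℂ) : LinearMap.BilinForm ℝ (ι → ℂ) :=
  LinearMap.mk₂ ℝ (fun ξ η => -(fderiv ℝ (fderiv ℝ u) z ξ η +
      fderiv ℝ (fderiv ℝ u) z (Complex.I • ξ) (Complex.I • η)) / 2)
    (fun _ _ _ => by simp only [smul_add, map_add, add_apply]; ring)
    (fun _ _ _ => by
      simp only [smul_comm Complex.I, map_smul, smul_apply, smul_eq_mul]; ring)
    (fun _ _ _ => by simp only [smul_add, map_add]; ring)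
    (fun _ _ _ => by simp only [smul_comm Complex.I, map_smul, smul_eq_mul]; ring)

theorem leviForm_apply (u : (ι → ℂ) → ℝ) (z ξ η : ι → ℂ) :
    leviForm u z ξ η = -(fderiv ℝ (fderiv ℝ u) z ξ η +
      fderiv ℝ (fderiv ℝ u) z (Complex.I • ξ) (Complex.I • η)) / 2 := rfl

variable [Fintype ι] {u : (ι → ℂ) → ℝ}

theorem hasDerivAt_comp_expLine (hu : ContDiff ℝ 2 u) (z a b : ι → ℂ) (s : ℝ) :
    HasDerivAt (fun s => u (expLine z a b s))
      (fderiv ℝ u (expLine z a b s) (expLine (z * a) a 0 s + b)) s :=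
  ((hu.differentiable two_ne_zero _).hasFDerivAt).comp_hasDerivAt s (hasDerivAt_expLine z a b s)

theorem hasDerivAt_fderiv_comp_expLine (hu : ContDiff ℝ 2 u) (z a b : ι → ℂ) (s : ℝ) :
    HasDerivAt (fun s => fderiv ℝ u (expLine z a b s) (expLine (z * a) a 0 s + b))
      (fderiv ℝ (fderiv ℝ u) (expLine z a b s) (expLine (z * a) a 0 s + b)
          (expLine (z * a) a 0 s + b) +
        fderiv ℝ u (expLine z a b s) (expLine (z * a * a) a 0 s)) s := by
  have hd : Differentiable ℝ (fderiv ℝ u) :=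
    (hu.fderiv_right (m := 1) (by norm_num)).differentiable one_ne_zero
  have h1 := ((hd (expLine z a b s)).hasFDerivAt).comp_hasDerivAt s (hasDerivAt_expLine z a b s)
  have h2 := (hasDerivAt_expLine (z * a) a 0 s).add_const b
  simpa using h1.clm_apply h2

theorem fderiv_fderiv_symm (hu : ContDiff ℝ 2 u) (z ξ η : ι → ℂ) :
    fderiv ℝ (fderiv ℝ u) z ξ η = fderiv ℝ (fderiv ℝ u) z η ξ :=
  (hu.contDiffAt.isSymmSndFDerivAt (by simp)).eq ξ η

theorem leviForm_symm (hu : ContDiff ℝ 2 u) (z ξ η : ι → ℂ) :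
    leviForm u z ξ η = leviForm u z η ξ := by
  rw [leviForm_apply, leviForm_apply, fderiv_fderiv_symm hu z ξ η, fderiv_fderiv_symm hu z (_ • ξ)]

theorem continuous_leviForm (hu : ContDiff ℝ 2 u) :
    Continuous fun p : (ι → ℂ) × (ι → ℂ) => leviForm u p.1 p.2 p.2 := by
  have hc : Continuous (fderiv ℝ (fderiv ℝ u)) :=
    (hu.fderiv_right (m := 1) (by norm_num)).continuous_fderiv one_ne_zero
  simp only [leviForm_apply]
  have h1 : Continuous fun p : (ι → ℂ) × (ι → ℂ) => fderiv ℝ (fderiv ℝ u) p.1 :=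
    hc.comp continuous_fst
  have h2 : Continuous fun p : (ι → ℂ) × (ι → ℂ) => Complex.I • p.2 :=
    continuous_pi fun j => continuous_const.mul ((continuous_apply j).comp continuous_snd)
  exact (((h1.clm_apply continuous_snd).clm_apply continuous_snd).add
    ((h1.clm_apply h2).clm_apply h2)).neg.div_const 2

/-- Along multiplicative curves log |z| is affine in s, so it does not affect second derivatives. -/
theorem log_norm_mul_exp {z : ℂ} (hz : z ≠ 0) (s : ℝ) (a : ℂ) :
    Real.log ‖z * Complex.exp (s * a)‖ = Real.log ‖z‖ + s * a.re := by
  rw [norm_mul, Real.log_mul (norm_ne_zero_iff.2 hz) (norm_ne_zero_iff.2 (Complex.exp_ne_zero _)),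
    Complex.norm_exp, Real.log_exp, Complex.re_ofReal_mul]

/-- At a maximum of `u + ∑ κ_j log |z_j|`, the form `-√-1 ∂∂̄ u` is positive semidefinite. -/
theorem leviForm_nonneg_of_isMax (hu : ContDiff ℝ 2 u) (κ : ι → ℝ) (z : ι → ℂ)
    (hκ : ∀ j, z j = 0 → κ j = 0)
    (hmax : ∀ w : ι → ℂ, (∀ j, z j ≠ 0 → w j ≠ 0) →
      u w + ∑ j, κ j * Real.log ‖w j‖ ≤ u z + ∑ j, κ j * Real.log ‖z j‖) (ξ : ι → ℂ) :
    0 ≤ leviForm u z ξ ξ := by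
  -- The curve is multiplicative where z_j ≠ 0 and may be additive where z_j = 0; there κ_j = 0, so
  -- the logarithm drops out. Thus u plus an affine function of s is maximal at s = 0.
  have key : ∀ a b : ι → ℂ, (∀ j, z j ≠ 0 → b j = 0) →
      fderiv ℝ (fderiv ℝ u) z (z * a + b) (z * a + b) + fderiv ℝ u z (z * a * a) ≤ 0 := by
    intro a b hb
    set C : ℝ := ∑ j, κ j * (a j).re
    have hF : ∀ s : ℝ, HasDerivAt (fun s => u (expLine z a b s) + s * C) _ s := fun s =>
      (hasDerivAt_comp_expLine hu z a b s).add ((hasDerivAt_id s).mul_const C)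
    have hF' := (hasDerivAt_fderiv_comp_expLine hu z a b 0).add_const (1 * C)
    simp only [expLine_zero] at hF'
    refine second_deriv_nonpos_of_isLocalMax (Filter.Eventually.of_forall fun s => ?_) hF hF'
    have hne : ∀ j, z j ≠ 0 → expLine z a b s j = z j * Complex.exp (s * a j) := by
      intro j hj
      simp [expLine, hb j hj]
    have h := hmax (expLine z a b s) fun j hj => by
      rw [hne j hj]
      exact mul_ne_zero hj (Complex.exp_ne_zero _)
    have hsum : ∑ j, κ j * Real.log ‖expLine z a b s j‖ =
        ∑ j, κ j * Real.log ‖z j‖ + s * C := by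
      rw [Finset.mul_sum, ← Finset.sum_add_distrib]
      refine Finset.sum_congr rfl fun j _ => ?_
      rcases eq_or_ne (z j) 0 with hj | hj
      · simp [hκ j hj]
      · rw [hne j hj, log_norm_mul_exp hj]
        ring
    rw [hsum] at h
    simp only [expLine_zero, zero_mul, add_zero]
    linarith
  set a : ι → ℂ := fun j => if z j = 0 then 0 else ξ j / z j
  set b : ι → ℂ := fun j => if z j = 0 then ξ j else 0
  have hab : z * a + b = ξ := by
    funext j
    by_cases hj : z j = 0
    · simp [a, b, hj]
    · simp [a, b, hj]
      field_simp
  have hb : ∀ j, z j ≠ 0 → b j = 0 := fun j hj => by simp [b, hj]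
  have h1 := key a b hb
  -- Adding the inequalities for ξ and iξ cancels the first-order terms, because (ia)² = -a².
  have h2 := key (Complex.I • a) (Complex.I • b) fun j hj => by simp [hb j hj]
  have e1 : z * Complex.I • a + Complex.I • b = Complex.I • ξ := by
    rw [← hab, smul_add, mul_smul_comm]
  rw [e1, mul_I_smul_mul_I_smul, map_neg] at h2
  rw [hab] at h1
  rw [leviForm_apply]
  linarith

/-- For a function `u` invariant under rotations of the coordinates, the second derivative along a
real one-parameter subgroup is given by the form `-√-1 ∂∂̄ u`. -/
theorem hasDerivAt_fderiv_of_invariant (hu : ContDiff ℝ 2 u)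
    (hinv : ∀ (τ : ι → ℝ) (z : ι → ℂ), u (fun j => z j * Complex.exp (τ j * Complex.I)) = u z)
    (z : ι → ℂ) (τ : ι → ℝ) (s : ℝ) :
    HasDerivAt (fun s => fderiv ℝ u (expLine z (fun j => (τ j : ℂ)) 0 s)
        (expLine (z * fun j => (τ j : ℂ)) (fun j => (τ j : ℂ)) 0 s))
      (-2 * leviForm u (expLine z (fun j => (τ j : ℂ)) 0 s)
        (expLine (z * fun j => (τ j : ℂ)) (fun j => (τ j : ℂ)) 0 s)
        (expLine (z * fun j => (τ j : ℂ)) (fun j => (τ j : ℂ)) 0 s)) s := by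
  set a : ι → ℂ := fun j => (τ j : ℂ)
  have hmul : ∀ x y : ι → ℂ, expLine (x * y) a 0 s = expLine x a 0 s * y := fun x y => by
    funext j; simp only [expLine, Pi.mul_apply, Pi.zero_apply]; ring
  -- Differentiate the constant function s ↦ u(w exp(isτ)) twice at 0; this trades the first-order
  -- term of the real curve for the second derivative in the direction rotated by i.
  have hrot : ∀ w : ι → ℂ, fderiv ℝ (fderiv ℝ u) w (Complex.I • (w * a)) (Complex.I • (w * a)) =
      fderiv ℝ u w (w * a * a) := by
    intro w
    have hconst : (fun s : ℝ => u (expLine w (Complex.I • a) 0 s)) = fun _ => u w := by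
      funext s
      rw [← hinv (s • τ) w]
      congr 1
      funext j
      simp only [expLine, a, Pi.smul_apply, smul_eq_mul, Pi.zero_apply, mul_zero, add_zero]
      push_cast
      ring_nf
    have h1 : (fun s => fderiv ℝ u (expLine w (Complex.I • a) 0 s)
        (expLine (w * Complex.I • a) (Complex.I • a) 0 s + 0)) = fun _ => 0 := by
      funext s
      have := hasDerivAt_comp_expLine hu w (Complex.I • a) 0 s
      rw [hconst] at this
      exact this.unique (hasDerivAt_const s (u w))
    have h2 := hasDerivAt_fderiv_comp_expLine hu w (Complex.I • a) 0 0
    rw [h1] at h2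
    have h3 := h2.unique (hasDerivAt_const (0 : ℝ) (0 : ℝ))
    simp only [expLine_zero, add_zero] at h3
    rw [mul_I_smul_mul_I_smul, map_neg, mul_smul_comm] at h3
    linarith
  have h := hasDerivAt_fderiv_comp_expLine hu z a 0 s
  simp only [add_zero] at h
  convert h using 1
  rw [leviForm_apply, hmul, hmul, hmul, hrot]
  ring

end ExpLine

/-! ### Positivity of the curvature form by a maximum principle -/

theorem pairing_toReal_sum {n r : ℕ} {F : SmoothCompleteFan n r} (σ : F.MaxCone) (q y : NR n) :
    pairing q y = ∑ j : σ.1, pairing q (toReal (F.v j)) * σ.coord j y := by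
  conv_lhs => rw [← σ.sum_coord y]
  simp only [pairing, WithLp.ofLp_sum, Finset.sum_apply, PiLp.smul_apply, smul_eq_mul,
    Finset.mul_sum, Finset.sum_mul]
  rw [Finset.sum_comm]
  exact Finset.sum_congr rfl fun _ _ => Finset.sum_congr rfl fun _ _ => by ring

namespace SmoothCompleteFan

variable {n r : ℕ} {F : SmoothCompleteFan n r}

theorem exists_expCoord_eq (σ : F.MaxCone) (x : σ.1 → ℝ) (hx : ∀ j, 0 < x j) :
    ∃ y : NR n, expCoord σ y = fun j => (x j : ℂ) :=
  ⟨∑ k, Real.log (x k) • toReal (F.v k), funext fun j => by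
    rw [expCoord, σ.coord_sum_smul, Real.exp_log (hx j)]⟩

variable (F) in
/-- Every `y ∈ N_ℝ` lies in the polydisc of some chart. -/
theorem exists_maxCone_coord_nonpos (y : NR n) : ∃ σ : F.MaxCone, ∀ j, σ.coord j y ≤ 0 := by
  obtain ⟨σ, hσ⟩ := F.exists_maxCone_mem (-y)
  exact ⟨σ, fun j => by simpa using (σ.mem_coneOver_iff _).1 hσ j⟩

namespace HermitianMetric

variable {c : Fin r → ℤ} (h : F.HermitianMetric c)

/-- This carries the nondegeneracy of ω_h over to the symmetric form, for which definiteness makes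
sense. -/
theorem omega_I_smul (σ : F.MaxCone) (z ξ η : Chart σ) :
    h.omega σ z ξ (Complex.I • η) = (leviForm (h.logWeight σ) z ξ η : ℝ) := by
  have hd : Differentiable ℝ (fderiv ℝ (h.logWeight σ)) :=
    ((h.contDiff_logWeight σ).fderiv_right (m := 1) (by norm_num)).differentiable one_ne_zero
  have hconn : ∀ η ξ : Chart σ, fderiv ℝ (fun w => h.connectionForm σ w η) z ξ =
      ((fderiv ℝ (fderiv ℝ (h.logWeight σ)) z ξ η : ℝ) -
        Complex.I * (fderiv ℝ (fderiv ℝ (h.logWeight σ)) z ξ (Complex.I • η) : ℝ)) / 2 := by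
    intro η ξ
    have h1 : ∀ η : Chart σ, HasFDerivAt (fun w => ((fderiv ℝ (h.logWeight σ) w η : ℝ) : ℂ))
        (Complex.ofRealCLM.comp ((fderiv ℝ (fderiv ℝ (h.logWeight σ)) z).flip η)) z := by
      intro η
      refine Complex.ofRealCLM.hasFDerivAt.comp z ?_
      have := (hd z).hasFDerivAt.clm_apply (hasFDerivAt_const η z)
      simpa using this
    have h2 := ((h1 η).sub ((h1 (Complex.I • η)).const_mul Complex.I)).mul_const (2 : ℂ)⁻¹
    have h3 : (fun w => h.connectionForm σ w η) = fun w =>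
        (((fderiv ℝ (h.logWeight σ) w η : ℝ) : ℂ) -
          Complex.I * (fderiv ℝ (h.logWeight σ) w (Complex.I • η) : ℝ)) * 2⁻¹ := by
      funext w
      rw [← div_eq_mul_inv]
      rfl
    rw [h3]
    erw [h2.fderiv]
    simp [div_eq_inv_mul]
  have hII : Complex.I • Complex.I • η = -η := by
    rw [smul_smul, Complex.I_mul_I, neg_one_smul]
  have hs := fderiv_fderiv_symm (h.contDiff_logWeight σ) z
  rw [omega, curvature, hconn, hconn, leviForm_apply, hII, map_neg, hs _ ξ,
    hs (Complex.I • η) (Complex.I • ξ)]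
  push_cast
  linear_combination (-(fderiv ℝ (fderiv ℝ (h.logWeight σ)) z ξ η : ℂ) -
    (fderiv ℝ (fderiv ℝ (h.logWeight σ)) z (Complex.I • ξ) (Complex.I • η) : ℂ)) / 2 *
      (-Complex.I_sq)

theorem leviForm_nondegenerate (hω : h.IsSymplectic) (σ : F.MaxCone) (z ξ : Chart σ)
    (hξ : ∀ η, leviForm (h.logWeight σ) z ξ η = 0) : ξ = 0 := by
  refine hω σ z ξ fun η => ?_
  have hη : η = Complex.I • (-Complex.I) • η := by
    rw [smul_smul, mul_neg, Complex.I_mul_I, neg_neg, one_smul]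
  rw [hη, omega_I_smul, hξ, Complex.ofReal_zero]

/-- The square of the norm of the (real) character `χ^q`, viewed as a section, in a chart. -/
def characterNormSq (q : MR n) (σ : F.MaxCone) (z : Chart σ) : ℝ :=
  h.weight σ z * ∏ j : σ.1, ‖z j‖ ^ (2 * (c j - pairing q (toReal (F.v j))))

/-- The right side does not involve σ, so the functions of different charts agree on the open orbit.
-/
theorem characterNormSq_expCoord (q : MR n) (σ : F.MaxCone) (y : NR n) :
    h.characterNormSq q σ (expCoord σ y) = Real.exp (2 * (h.inv.potential y - pairing q y)) := by
  have h1 : ∀ j : σ.1, ‖expCoord σ y j‖ ^ (2 * (c j - pairing q (toReal (F.v j)))) =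
      Real.exp (2 * ((c j - pairing q (toReal (F.v j))) * σ.coord j y)) := by
    intro j
    rw [expCoord, Complex.norm_real, Real.norm_of_nonneg (Real.exp_pos _).le, ← Real.exp_mul]
    ring_nf
  rw [characterNormSq, Finset.prod_congr rfl fun j _ => h1 j, ← Real.exp_sum,
    ← Real.exp_log (h.pos σ (expCoord σ y)), ← Real.exp_add, h.inv_potential_eq σ,
    pairing_toReal_sum σ q y, ← Finset.mul_sum]
  simp only [sub_mul, Finset.sum_sub_distrib, logWeight]
  ring_nf

theorem characterNormSq_pos (q : MR n) (σ : F.MaxCone) (y : NR n) :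
    0 < h.characterNormSq q σ (expCoord σ y) := by
  rw [characterNormSq_expCoord]
  exact Real.exp_pos _

variable {q : MR n} (hq : ∀ i, pairing q (toReal (F.v i)) ≤ c i)
include hq

/-- Membership of q in the polytope makes all exponents nonnegative, so nothing blows up on the
divisors. -/
theorem continuous_characterNormSq (σ : F.MaxCone) : Continuous (h.characterNormSq q σ) := by
  refine (AnalyticOnNhd.contDiff (h.analytic σ) (n := 0)).continuous.mul ?_
  refine continuous_finsetProd _ fun j _ => ?_
  exact (Real.continuous_rpow_const (by linarith [hq j])).comp (continuous_apply j).norm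

omit hq in
theorem characterNormSq_eq_norm (σ : F.MaxCone) (z : Chart σ) :
    h.characterNormSq q σ z = h.characterNormSq q σ fun j => (‖z j‖ : ℂ) := by
  have h1 : h.logWeight σ z = h.logWeight σ fun j => (‖z j‖ : ℂ) := by
    rw [← h.logWeight_invariant σ (fun j => Complex.arg (z j)) fun j => (‖z j‖ : ℂ)]
    simp only [Complex.norm_mul_exp_arg_mul_I]
  have h2 := Real.log_injOn_pos (h.pos σ _) (h.pos σ _) h1
  rw [characterNormSq, characterNormSq, h2]
  simp

/-- The norm of a character in the polytope attains its maximum on the toric variety. -/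
theorem exists_characterNormSq_max : ∃ (σ : F.MaxCone) (z : Chart σ),
    0 < h.characterNormSq q σ z ∧ ∀ w, h.characterNormSq q σ w ≤ h.characterNormSq q σ z := by
  -- The closed unit polydiscs (balls of the sup norm) stand in for compactness of the variety:
  -- every exp y lies in one of them.
  have hcomp : ∀ σ : F.MaxCone, ∃ z ∈ Metric.closedBall (0 : Chart σ) 1,
      ∀ w ∈ Metric.closedBall (0 : Chart σ) 1,
        h.characterNormSq q σ w ≤ h.characterNormSq q σ z := fun σ =>
    (isCompact_closedBall (0 : Chart σ) 1).exists_isMaxOn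
      ⟨0, Metric.mem_closedBall_self zero_le_one⟩ (h.continuous_characterNormSq hq σ).continuousOn
  choose z _ hz using hcomp
  have := F.nonempty_maxCone
  obtain ⟨σ, hσ⟩ := Finite.exists_max fun σ => h.characterNormSq q σ (z σ)
  have hexp : ∀ (τ : F.MaxCone) (y : NR n),
      h.characterNormSq q τ (expCoord τ y) ≤ h.characterNormSq q σ (z σ) := by
    intro τ y
    obtain ⟨σ', hσ'⟩ := F.exists_maxCone_coord_nonpos y
    rw [characterNormSq_expCoord, ← h.characterNormSq_expCoord q σ']
    refine (hz σ' _ ?_).trans (hσ σ')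
    rw [mem_closedBall_zero_iff, pi_norm_le_iff_of_nonneg zero_le_one]
    intro j
    rw [expCoord, Complex.norm_real, Real.norm_of_nonneg (Real.exp_pos _).le]
    exact Real.exp_le_one_iff.2 (hσ' j)
  refine ⟨σ, z σ, (h.characterNormSq_pos q σ 0).trans_le (hexp σ 0), fun w => ?_⟩
  -- The bound is known on the open orbit, after rotating the coordinates to positive reals; density
  -- extends it to the whole chart.
  have hdense : Dense (Set.univ.pi fun _ : σ.1 => ({0}ᶜ : Set ℂ)) :=
    dense_pi _ fun _ _ => dense_compl_singleton 0
  have hclosed : IsClosed {w | h.characterNormSq q σ w ≤ h.characterNormSq q σ (z σ)} :=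
    isClosed_le (h.continuous_characterNormSq hq σ) continuous_const
  refine (hclosed.closure_subset_iff.2 fun x hx => ?_) (hdense w)
  obtain ⟨y, hy⟩ := exists_expCoord_eq σ (fun j => ‖x j‖)
    fun j => norm_pos_iff.2 (hx j (Set.mem_univ j))
  rw [Set.mem_ofPred_eq, characterNormSq_eq_norm, ← hy]
  exact hexp σ y

/-- If `ω_h` is symplectic and the polytope is nonempty, then `ω_h` is positive on some chart. -/
theorem exists_leviForm_pos (hω : h.IsSymplectic) : ∃ σ : F.MaxCone,
    ∀ z ξ : Chart σ, ξ ≠ 0 → 0 < leviForm (h.logWeight σ) z ξ ξ := by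
  obtain ⟨σ, z, hpos, hmax⟩ := h.exists_characterNormSq_max hq
  refine ⟨σ, bilinForm_pos_of_preconnectedSpace _ (continuous_leviForm (h.contDiff_logWeight σ))
    (leviForm_symm (h.contDiff_logWeight σ)) (h.leviForm_nondegenerate hω σ) z ?_⟩
  set κ : σ.1 → ℝ := fun j => 2 * (c j - pairing q (toReal (F.v j)))
  -- The maximum is positive, so no factor 0^κ_j with κ_j ≠ 0 can occur in it.
  have hκ : ∀ j, z j = 0 → κ j = 0 := by
    intro j hj
    by_contra hne
    refine hpos.ne' ?_
    rw [characterNormSq, Finset.prod_eq_zero (Finset.mem_univ j), mul_zero]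
    rw [hj, norm_zero]
    exact Real.zero_rpow hne
  refine leviForm_nonneg_of_isMax (h.contDiff_logWeight σ) κ z hκ fun w hw => ?_
  have hlog : ∀ w : Chart σ, (∀ j, z j ≠ 0 → w j ≠ 0) →
      h.logWeight σ w + ∑ j, κ j * Real.log ‖w j‖ = Real.log (h.characterNormSq q σ w) ∧
        0 < h.characterNormSq q σ w := by
    intro w hw
    have hterm : ∀ j, 0 < ‖w j‖ ^ κ j ∧ κ j * Real.log ‖w j‖ = Real.log (‖w j‖ ^ κ j) := by
      intro j
      by_cases hj : z j = 0
      · simp [hκ j hj]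
      · have := norm_pos_iff.2 (hw j hj)
        exact ⟨Real.rpow_pos_of_pos this _, (Real.log_rpow this _).symm⟩
    have hprod : 0 < ∏ j, ‖w j‖ ^ κ j := Finset.prod_pos fun j _ => (hterm j).1
    refine ⟨?_, mul_pos (h.pos σ w) hprod⟩
    rw [characterNormSq, Real.log_mul (h.pos σ w).ne' hprod.ne',
      Real.log_prod fun j _ => (hterm j).1.ne', Finset.sum_congr rfl fun j _ => (hterm j).2,
      logWeight]
  rw [(hlog w hw).1, (hlog z fun _ => id).1]
  exact Real.log_le_log (hlog w hw).2 (hmax w)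

end HermitianMetric
end SmoothCompleteFan

/-! ### The moment map: strict concavity and values in the open polytope -/

theorem pairing_eq_inner {n : ℕ} (m y : NR n) : pairing m y = inner ℝ m y := by
  rw [pairing, PiLp.inner_apply]
  exact Finset.sum_congr rfl fun j _ => by simp [mul_comm]

namespace SmoothCompleteFan

variable {n r : ℕ} {F : SmoothCompleteFan n r}

theorem expCoord_add_smul (σ : F.MaxCone) (y a : NR n) (s : ℝ) :
    expCoord σ (y + s • a) = expLine (expCoord σ y) (fun j => (σ.coord j a : ℂ)) 0 s := by
  funext j
  simp [expCoord, expLine, Real.exp_add]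

theorem differentiable_expCoord (σ : F.MaxCone) : Differentiable ℝ (expCoord σ) := by
  rw [differentiable_pi]
  intro j
  exact Complex.ofRealCLM.differentiable.comp (σ.coord j).differentiable.exp

theorem MaxCone.eq_zero_of_coord_eq_zero (σ : F.MaxCone) {x : NR n} (hx : ∀ j, σ.coord j x = 0) :
    x = 0 := by
  rw [← σ.sum_coord x]
  exact Finset.sum_eq_zero fun j _ => by rw [hx j, zero_smul]

theorem MaxCone.ext_pairing (σ : F.MaxCone) {m m' : MR n}
    (hm : ∀ j : σ.1, pairing m (toReal (F.v j)) = pairing m' (toReal (F.v j))) : m = m' := by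
  refine ext_inner_right ℝ fun y => ?_
  rw [← pairing_eq_inner, ← pairing_eq_inner, pairing_toReal_sum σ, pairing_toReal_sum σ m']
  exact Finset.sum_congr rfl fun j _ => by rw [hm j]

namespace HermitianMetric

variable {c : Fin r → ℤ} (h : F.HermitianMetric c)

theorem pairing_momentMap (y a : NR n) :
    pairing (h.momentMap y) a = fderiv ℝ h.potential y a := by
  have ha : a = ∑ j, a j • EuclideanSpace.single j (1 : ℝ) := by
    ext i
    simp [Pi.single_apply]
  conv_rhs => rw [ha]
  rw [map_sum, pairing]
  exact Finset.sum_congr rfl fun j _ => by simp [momentMap, mul_comm]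

theorem differentiable_inv_potential : Differentiable ℝ h.inv.potential := by
  obtain ⟨σ⟩ := F.nonempty_maxCone
  rw [funext (h.inv_potential_eq σ)]
  refine Differentiable.add ?_ ?_
  · exact Differentiable.fun_sum fun j _ => (σ.coord j).differentiable.const_mul _
  · have h1 : Differentiable ℝ fun y => h.logWeight σ (expCoord σ y) :=
      ((h.contDiff_logWeight σ).differentiable two_ne_zero).comp (differentiable_expCoord σ)
    simpa only [div_eq_mul_inv] using h1.mul_const (2 : ℝ)⁻¹

theorem pairing_inv_momentMap_add_smul (σ : F.MaxCone) (y a : NR n) (s : ℝ) :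
    pairing (h.inv.momentMap (y + s • a)) a = ∑ j : σ.1, (c j : ℝ) * σ.coord j a +
      fderiv ℝ (h.logWeight σ) (expLine (expCoord σ y) (fun j => (σ.coord j a : ℂ)) 0 s)
        (expLine (expCoord σ y * fun j => (σ.coord j a : ℂ))
          (fun j => (σ.coord j a : ℂ)) 0 s) / 2 := by
  rw [pairing_momentMap]
  have h1 : HasDerivAt (fun s : ℝ => h.inv.potential (y + s • a))
      (fderiv ℝ h.inv.potential (y + s • a) a) s := by
    refine ((h.differentiable_inv_potential _).hasFDerivAt).comp_hasDerivAt s ?_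
    simpa using ((hasDerivAt_id s).smul_const a).const_add y
  refine h1.unique ?_
  have h2 := hasDerivAt_comp_expLine (h.contDiff_logWeight σ) (expCoord σ y)
    (fun j => (σ.coord j a : ℂ)) 0 s
  have h3 : HasDerivAt (fun s : ℝ => ∑ j : σ.1, (c j : ℝ) * σ.coord j (y + s • a))
      (∑ j : σ.1, (c j : ℝ) * σ.coord j a) s := by
    refine HasDerivAt.fun_sum fun j _ => ?_
    simp only [map_add, map_smul, smul_eq_mul]
    simpa using (((hasDerivAt_id s).mul_const (σ.coord j a)).const_add (σ.coord j y)).const_mul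
      (c j : ℝ)
  simp only [add_zero] at h2
  refine (h3.add (h2.div_const 2)).congr_of_eventuallyEq (Eventually.of_forall fun t => ?_)
  simp only [h.inv_potential_eq σ, expCoord_add_smul, Pi.add_apply]

/-- The logarithmic derivative of `h_σ` in the direction of the `j`-th coordinate, halved. -/
def radialDeriv (σ : F.MaxCone) (j : σ.1) (z : Chart σ) : ℝ :=
  fderiv ℝ (h.logWeight σ) z (Pi.single j (z j)) / 2

theorem continuous_radialDeriv (σ : F.MaxCone) (j : σ.1) : Continuous (h.radialDeriv σ j) := by
  have h1 : Continuous fun z : Chart σ => (Pi.single j (z j) : Chart σ) :=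
    (continuous_single j).comp (continuous_apply j)
  exact (((h.contDiff_logWeight σ).continuous_fderiv two_ne_zero).clm_apply h1).div_const 2

/-- The field Z_j ∂/∂Z_j vanishes on Z_j = 0; this is why limits on that divisor land on the facet
of v_j. -/
theorem radialDeriv_eq_zero (σ : F.MaxCone) (j : σ.1) {z : Chart σ} (hz : z j = 0) :
    h.radialDeriv σ j z = 0 := by
  simp [radialDeriv, hz]

/-- Moving along v_j rescales only the coordinate Z_j. The right side is continuous on the whole
chart, which gives the limits of the moment map at infinity. -/
theorem pairing_inv_momentMap_ray (σ : F.MaxCone) (j : σ.1) (y : NR n) :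
    pairing (h.inv.momentMap y) (toReal (F.v j)) =
      c j + h.radialDeriv σ j (expCoord σ y) := by
  have h1 := h.pairing_inv_momentMap_add_smul σ y (toReal (F.v j)) 0
  have h2 : (expCoord σ y * fun k => (σ.coord k (toReal (F.v j)) : ℂ)) =
      Pi.single j (expCoord σ y j) := by
    funext k
    rcases eq_or_ne k j with rfl | hk
    · simp [σ.coord_toReal]
    · simp [σ.coord_toReal, hk]
  rw [zero_smul, add_zero, expLine_zero, expLine_zero, h2] at h1
  rw [h1, radialDeriv]
  simp [σ.coord_toReal]

variable {q : MR n} (hq : ∀ i, pairing q (toReal (F.v i)) ≤ c i) (hω : h.IsSymplectic)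
include hq hω

/-- The potential of `h⁻¹` is strictly concave. -/
theorem strictAnti_pairing_inv_momentMap (y : NR n) {a : NR n} (ha : a ≠ 0) :
    StrictAnti fun s : ℝ => pairing (h.inv.momentMap (y + s • a)) a := by
  obtain ⟨σ, hσ⟩ := h.exists_leviForm_pos hq hω
  simp only [h.pairing_inv_momentMap_add_smul σ y a]
  have hd := fun s => ((hasDerivAt_fderiv_of_invariant (h.contDiff_logWeight σ)
    (h.logWeight_invariant σ) (expCoord σ y) (fun j => σ.coord j a) s).div_const 2).const_add
      (∑ j : σ.1, (c j : ℝ) * σ.coord j a)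
  refine strictAnti_of_deriv_neg fun s => ?_
  rw [(hd s).deriv]
  have := hσ (expLine (expCoord σ y) (fun j => (σ.coord j a : ℂ)) 0 s)
    (expLine (expCoord σ y * fun j => (σ.coord j a : ℂ)) (fun j => (σ.coord j a : ℂ)) 0 s) ?_
  · linarith
  · intro h0
    refine ha (σ.eq_zero_of_coord_eq_zero fun j => ?_)
    have := congrFun h0 j
    simpa [expLine, expCoord] using this

/-- The moment map takes values in the interior of the polytope. -/
theorem pairing_inv_momentMap_lt (y : NR n) (i : Fin r) :
    pairing (h.inv.momentMap y) (toReal (F.v i)) < c i := by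
  obtain ⟨σ, hi⟩ := F.exists_maxCone_ray_mem i
  have hanti := h.strictAnti_pairing_inv_momentMap hq hω y (F.v_ne_zero i)
  set j : σ.1 := ⟨i, hi⟩
  -- Going to -∞ along v_i sends Z_i to 0 and leaves the other coordinates of the chart fixed.
  have hlim : Tendsto (fun s : ℝ => pairing (h.inv.momentMap (y + s • toReal (F.v i)))
      (toReal (F.v i))) atBot (𝓝 (c i)) := by
    have h1 : Tendsto (fun s : ℝ => expCoord σ (y + s • toReal (F.v i))) atBot
        (𝓝 (Function.update (expCoord σ y) j 0)) := by
      rw [tendsto_pi_nhds]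
      intro k
      have hk := σ.coord_toReal k j
      simp only [expCoord, map_add, map_smul, smul_eq_mul]
      rcases eq_or_ne k j with rfl | hkj
      · rw [Function.update_self, if_pos rfl] at *
        rw [hk, ← Complex.ofReal_zero]
        refine (Complex.continuous_ofReal.tendsto 0).comp (Real.tendsto_exp_atBot.comp ?_)
        simpa using tendsto_atBot_add_const_left atBot (σ.coord j y) tendsto_id
      · rw [Function.update_of_ne hkj, hk, if_neg hkj]
        simp [expCoord]
    have h2 := ((h.continuous_radialDeriv σ j).tendsto _).comp h1
    rw [h.radialDeriv_eq_zero σ j (Function.update_self _ _ _)] at h2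
    have h3 := h2.const_add (c i : ℝ)
    rw [add_zero] at h3
    exact h3.congr fun s => (h.pairing_inv_momentMap_ray σ j _).symm
  -- Comparison with s = -1 keeps the inequality strict, since the limit bounds values only weakly.
  have h1 := hanti (show (-1 : ℝ) < 0 by norm_num)
  have h2 := hanti.antitone.ge_of_tendsto hlim (-1)
  simp only [zero_smul, add_zero] at h1
  exact h1.trans_le h2

end HermitianMetric

theorem exists_pairing_eq_of_mem_frontier {c : Fin r → ℤ} {q : MR n}
    (hq : q ∈ frontier (F.negPolytope c)) :
    (∀ i, pairing q (toReal (F.v i)) ≤ c i) ∧ ∃ i, pairing q (toReal (F.v i)) = c i := by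
  have hset : F.negPolytope c = ⋂ i, {m | pairing m (toReal (F.v i)) ≤ c i} := by
    ext m
    simp [negPolytope, polytope, pairing_eq_inner]
  have hcont : ∀ i, Continuous fun m : MR n => pairing m (toReal (F.v i)) := fun i => by
    simp only [pairing_eq_inner]
    fun_prop
  have hclosed : IsClosed (F.negPolytope c) := by
    rw [hset]
    exact isClosed_iInter fun i => isClosed_le (hcont i) continuous_const
  have hmem : ∀ i, pairing q (toReal (F.v i)) ≤ c i := by
    have := hclosed.frontier_subset hq
    rw [hset] at this
    exact Set.mem_iInter.1 this
  refine ⟨hmem, ?_⟩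
  by_contra! hne
  refine hq.2 (mem_interior_iff_mem_nhds.2 ?_)
  rw [hset]
  refine iInter_mem.2 fun i => ?_
  have hev : ∀ᶠ m in 𝓝 q, pairing m (toReal (F.v i)) ≤ c i :=
    (((hcont i).continuousAt (x := q)).eventually_lt_const
      (lt_of_le_of_ne (hmem i) (hne i))).mono fun m hm => hm.le
  exact hev

end SmoothCompleteFan

/-! ### The gap at a boundary point -/

namespace SmoothCompleteFan

variable {n r : ℕ} {F : SmoothCompleteFan n r}

/-- If `⟨y, v_j⟩ ≥ 0` and the coordinate of `y` along `v_j` is nonpositive for all `j ∈ S`, then the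
part of `y` along the rays in `S` is bounded by the part along the other rays. -/
theorem norm_sum_le_of_inner_nonneg (σ : F.MaxCone) (S : Finset σ.1) (y : NR n)
    (hy : ∀ j ∈ S, 0 ≤ inner ℝ y (toReal (F.v j))) (hS : ∀ j ∈ S, σ.coord j y ≤ 0) :
    ‖∑ j ∈ S, σ.coord j y • toReal (F.v j)‖ ≤ ‖∑ j ∈ Sᶜ, σ.coord j y • toReal (F.v j)‖ := by
  set A := ∑ j ∈ S, σ.coord j y • toReal (F.v j)
  set B := ∑ j ∈ Sᶜ, σ.coord j y • toReal (F.v j)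
  have hAB : A + B = y := (Finset.sum_add_sum_compl S _).trans (σ.sum_coord y)
  have h1 : inner ℝ y A ≤ 0 := by
    rw [inner_sum]
    refine Finset.sum_nonpos fun j hj => ?_
    rw [inner_smul_right]
    exact mul_nonpos_of_nonpos_of_nonneg (hS j hj) (hy j hj)
  have h2 : inner ℝ y A = ‖A‖ ^ 2 + inner ℝ B A := by
    rw [← hAB, inner_add_left, real_inner_self_eq_norm_sq]
  -- Together these give |A|² ≤ -⟨B, A⟩ ≤ |A||B|.
  have h3 := neg_le_of_abs_le (abs_real_inner_le_norm B A)
  by_contra! hlt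
  nlinarith [norm_nonneg A, norm_nonneg B]

namespace HermitianMetric

variable {c : Fin r → ℤ} (h : F.HermitianMetric c)

theorem exists_gap_of_mem_frontier (hω : h.IsSymplectic) {q : MR n}
    (hq : q ∈ frontier (F.negPolytope c)) :
    ∃ δ : ℝ, 0 < δ ∧ ∀ (t : ℝ) (y : NR n), 0 ≤ t → t < δ → y ≠ 0 →
      q - h.inv.momentMap y ≠ (t / ‖y‖) • y := by
  obtain ⟨hle, i, hi⟩ := exists_pairing_eq_of_mem_frontier hq
  have hlt := h.pairing_inv_momentMap_lt hle hω
  by_contra! hcon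
  choose t y ht0 ht1 hy0 heq using fun k : ℕ => hcon (1 / ((k : ℝ) + 1)) (by positivity)
  -- An ultrafilter replaces successive subsequences: it selects one of the finitely many cones and
  -- a limit of the chart coordinates.
  set l : Ultrafilter ℕ := hyperfilter ℕ
  have hl : (l : Filter ℕ) ≤ atTop := Nat.hyperfilter_le_atTop
  have ht : Tendsto t l (𝓝 0) :=
    (squeeze_zero ht0 (fun k => (ht1 k).le) tendsto_one_div_add_atTop_nhds_zero_nat).mono_left hl
  have hnorm : ∀ k, ‖q - h.inv.momentMap (y k)‖ = t k := by
    intro k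
    have := norm_ne_zero_iff.2 (hy0 k)
    rw [heq, norm_smul, Real.norm_of_nonneg (div_nonneg (ht0 k) (norm_nonneg _))]
    field_simp
  have hmom : Tendsto (fun k => h.inv.momentMap (y k)) l (𝓝 q) := by
    have h1 : Tendsto (fun k => q - h.inv.momentMap (y k)) l (𝓝 0) := by
      rw [tendsto_zero_iff_norm_tendsto_zero]
      simpa only [hnorm] using ht
    simpa using (tendsto_const_nhds (x := q)).sub h1
  obtain ⟨σ, hσ⟩ : ∃ σ : F.MaxCone, ∀ᶠ k in (l : Filter ℕ), ∀ j, σ.coord j (y k) ≤ 0 := by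
    have : (⋃ σ ∈ (Set.univ : Set F.MaxCone), {k | ∀ j, σ.coord j (y k) ≤ 0}) ∈ l := by
      refine Filter.mem_of_superset Filter.univ_mem fun k _ => ?_
      obtain ⟨σ, hσ⟩ := F.exists_maxCone_coord_nonpos (y k)
      exact Set.mem_iUnion₂.2 ⟨σ, Set.mem_univ _, hσ⟩
    obtain ⟨σ, -, hσ⟩ := (Ultrafilter.finite_biUnion_mem_iff Set.finite_univ).1 this
    exact ⟨σ, hσ⟩
  obtain ⟨x, -, hx⟩ : ∃ x ∈ Set.Icc (0 : σ.1 → ℝ) 1,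
      Tendsto (fun k j => Real.exp (σ.coord j (y k))) l (𝓝 x) := by
    refine isCompact_Icc.ultrafilter_le_nhds' (l.map _) ?_
    refine hσ.mono fun k hk => ⟨fun j => (Real.exp_pos _).le, fun j => ?_⟩
    exact Real.exp_le_one_iff.2 (hk j)
  have hxj := tendsto_pi_nhds.1 hx
  have hx0 : ∀ j, 0 ≤ x j := fun j => ge_of_tendsto' (hxj j) fun k => (Real.exp_pos _).le
  have hZ : Tendsto (fun k => expCoord σ (y k)) l (𝓝 fun j => (x j : ℂ)) :=
    tendsto_pi_nhds.2 fun j => (Complex.continuous_ofReal.tendsto _).comp (hxj j)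
  have hqv : ∀ j : σ.1, pairing q (toReal (F.v j)) =
      c j + h.radialDeriv σ j fun j => (x j : ℂ) := by
    intro j
    have h1 := (((h.continuous_radialDeriv σ j).tendsto _).comp hZ).const_add (c j : ℝ)
    have h2 : Tendsto (fun k => pairing (h.inv.momentMap (y k)) (toReal (F.v j))) l
        (𝓝 (pairing q (toReal (F.v j)))) := by
      simp only [pairing_eq_inner]
      exact hmom.inner tendsto_const_nhds
    exact tendsto_nhds_unique h2 (h1.congr fun k => (h.pairing_inv_momentMap_ray σ j _).symm)
  -- If no coordinate vanishes in the limit, q is itself a value of the moment map, which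
  -- contradicts its lying on a facet.
  by_cases hS : ∀ j, 0 < x j
  · obtain ⟨y', hy'⟩ := exists_expCoord_eq σ x hS
    have hqy : q = h.inv.momentMap y' := σ.ext_pairing fun j => by
      rw [hqv, h.pairing_inv_momentMap_ray σ, hy']
    have := hlt y' i
    rw [← hqy, hi] at this
    exact lt_irrefl _ this
  push Not at hS
  obtain ⟨j₀, hj₀⟩ := hS
  set S : Finset σ.1 := Finset.univ.filter fun j => x j = 0
  have hj₀S : j₀ ∈ S := by simp [S, le_antisymm hj₀ (hx0 j₀)]
  -- Here ⟨q, v_j⟩ = c_j exceeds ⟨Φ(y_k), v_j⟩, and q - Φ(y_k) is a nonnegative multiple of y_k.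
  have hinner : ∀ k, ∀ j ∈ S, 0 ≤ inner ℝ (y k) (toReal (F.v j)) := by
    intro k j hj
    have hxz : x j = 0 := (Finset.mem_filter.1 hj).2
    have h1 := hqv j
    rw [h.radialDeriv_eq_zero σ j (by simp [hxz]), add_zero] at h1
    have h2 := hlt (y k) j
    rw [← h1, pairing_eq_inner, pairing_eq_inner, ← sub_pos, ← inner_sub_left, heq,
      inner_smul_left] at h2
    exact (pos_of_mul_pos_right h2 (div_nonneg (ht0 k) (norm_nonneg _))).le
  have hcoord : ∀ j ∉ S, Tendsto (fun k => σ.coord j (y k)) l (𝓝 (Real.log (x j))) := by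
    intro j hj
    have hne : x j ≠ 0 := fun h0 => hj (by simp [S, h0])
    simpa using (hxj j).log hne
  have hB : Tendsto (fun k => ∑ j ∈ Sᶜ, σ.coord j (y k) • toReal (F.v j)) l
      (𝓝 (∑ j ∈ Sᶜ, Real.log (x j) • toReal (F.v j))) :=
    tendsto_finsetSum _ fun j hj =>
      (hcoord j (Finset.mem_compl.1 hj)).smul tendsto_const_nhds
  have hA : ∀ k, σ.coord j₀ (∑ j ∈ S, σ.coord j (y k) • toReal (F.v j)) = σ.coord j₀ (y k) := by
    intro k
    simp [map_sum, σ.coord_toReal, hj₀S]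
  have hbot : Tendsto (fun k => σ.coord j₀ (y k)) l atBot := by
    have h0 : x j₀ = 0 := le_antisymm hj₀ (hx0 j₀)
    have := hxj j₀
    rw [h0] at this
    exact Real.tendsto_exp_comp_nhds_zero.1 this
  set R := ‖∑ j ∈ Sᶜ, Real.log (x j) • toReal (F.v j)‖
  -- The part outside S is eventually shorter than R + 1, hence so is the S-part, whose
  -- j₀-coordinate nevertheless tends to -∞.
  have hev := hB.norm.eventually_lt_const (lt_add_one R)
  obtain ⟨k, hk1, hk2, hk3⟩ := (hσ.and (hev.and
    (hbot.eventually_lt_atBot (-(‖σ.coord j₀‖ * (R + 1)))))).exists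
  have h1 := norm_sum_le_of_inner_nonneg σ S (y k) (hinner k) fun j _ => hk1 j
  have h2 := (σ.coord j₀).le_opNorm (∑ j ∈ S, σ.coord j (y k) • toReal (F.v j))
  rw [hA, Real.norm_eq_abs] at h2
  have h3 := neg_le_of_abs_le (h2.trans
    (mul_le_mul_of_nonneg_left (h1.trans hk2.le) (norm_nonneg _)))
  linarith

end HermitianMetric
end SmoothCompleteFan

end Toric

end

theorem mainTheorem11 {n r : ℕ} (F : Toric.SmoothCompleteFan n r) (c : Fin r → ℤ)
    (hc : F.IsAmple c) (h : F.HermitianMetric c) (hω : h.IsSymplectic)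
    (q : Toric.MR n) (hq : q ∈ frontier (F.negPolytope c)) :
    ∃ δ : ℝ, 0 < δ ∧ ∀ t₁ t₂ : ℝ, 0 ≤ t₁ → t₁ ≤ t₂ → t₂ < δ →
      (Toric.geodesicFlow t₁ '' Toric.offZeroSection (Toric.cotangentFiber q)) ∩
        (Toric.geodesicFlow t₂ '' Toric.offZeroSection h.inv.tDual) = ∅ := by
  obtain ⟨δ, hδ, hgap⟩ := h.exists_gap_of_mem_frontier hω hq
  refine ⟨δ, hδ, fun t₁ t₂ h0 h12 h2 => Set.eq_empty_of_forall_notMem ?_⟩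
  rintro p ⟨⟨⟨x₁, y⟩, ⟨hx₁, hy⟩, rfl⟩, ⟨x₂, y'⟩, ⟨hx₂, -⟩, hp⟩
  have hx₁' : x₁ = q := hx₁
  have hx₂' : x₂ = h.inv.momentMap y' := hx₂
  have hyy : y' = y := congrArg Prod.snd hp
  subst hyy
  have h1 : x₂ + (t₂ / ‖y'‖) • y' = x₁ + (t₁ / ‖y'‖) • y' := congrArg Prod.fst hp
  refine hgap (t₂ - t₁) y' (by linarith) (by linarith) hy ?_
  rw [sub_div, sub_smul, ← hx₁', ← hx₂', sub_eq_sub_iff_add_eq_add, add_comm _ x₂, h1]
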